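/- **Lemma.** For a morphism $f\colon \tilde S\to S$ of integral Noetherian schemes, an *exceptional divisor* of $f$ is a prime divisor $E\subset\tilde S$ whose image $f(E)$ has codimension at least $2$ in $S$. A morphism is *birational* if it restricts to an isomorphism between dense open subschemes of source and target. (1) Let $f\colon\tilde S\to S$ be a proper birational morphism of integral normal Noetherian schemes (for example, of integral normal varieties over a field). Then the exceptional divisors of $f$ are linearly independent over $\mathbb Z$ in the divisor class group $\mathrm{Cl}(\tilde S)$. (2) Let $k$ be a number field, $A$ an abelian variety over $k$ of dimension $\ge 2$, and $\zeta$ an automorphism of the abelian variety $A$, defined over $k$, of prime order $p>2$ and with only finitely many fixed points in $A(\overline k)$; let $T\subset A$ be the group of fixed points. Let $Y$ be a torsor of $A$ whose class lies in the image of $H^1(k,T)\to H^1(k,A)$, with the induced automorphism of $Y$ over $k$, again denoted $\zeta$. (That is, there is a point $y\in Y(\overline k)$ such that every Galois conjugate of $y$ has the form $t\cdot y$ with $t\in T(\overline k)$, and $\zeta(a\cdot y)=\zeta(a)\cdot y$.) Let $X\to Y/\langle\zeta\rangle$ be a resolution of singularities, that is, a proper birational morphism over $k$ with $X$ integral and smooth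 over $k$; for example, let $X$ be a generalized Kummer variety attached to $A$, $\zeta$ and $Y$. Then the exceptional divisors of $X\to Y/\langle\zeta\rangle$ are linearly independent over $\mathbb Z$ in $\mathrm{Cl}(X)$, and the classes $[\mathcal O_X(E)]$ of the exceptional divisors $E$ are linearly independent over $\mathbb Z$ in $\mathrm{Pic}(X)$. -/

import Mathlib

open CategoryTheory AlgebraicGeometry Order

universe u

noncomputable section

namespace ExcDiv

/-! ### Normal schemes, birational morphisms, exceptional divisors -/

/-- A scheme is normal if all its local rings are integrally closed (for an integral scheme these
local rings are domains, so that they are normal domains). -/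
def IsNormalScheme (X : Scheme.{u}) : Prop :=
  ∀ x : X, IsIntegrallyClosed (X.presheaf.stalk x)

/-- The morphism `f : X ⟶ Y` is birational: it restricts to an isomorphism from a dense open
subscheme of `X` onto a dense open subscheme of `Y`. -/
def IsBirationalMorphism {X Y : Scheme.{u}} (f : X ⟶ Y) : Prop :=
  ∃ φ : Scheme.PartialIso X Y, φ.iso.hom ≫ φ.target.ι = φ.source.ι ≫ f

/-- Prime divisors on `X`, given by their generic points: the points of codimension one. -/
abbrev PrimeDivisor (X : Scheme.{u}) : Type u := {x : X // coheight x = 1}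

/-- The exceptional (prime) divisors of `f : X ⟶ Y`: the prime divisors `E` of `X` whose image
`f(E)` has codimension at least two in `Y`. -/
def ExceptionalDivisor {X Y : Scheme.{u}} (f : X ⟶ Y) : Type u :=
  {E : PrimeDivisor X // 2 ≤ coheight (f E.1)}

/-! ### Weil divisors and the divisor class group -/

/-- Weil divisors on a Noetherian scheme. -/
abbrev WeilDivisor (X : Scheme.{u}) : Type u := PrimeDivisor X →₀ ℤ

section ClassGroup

variable (X : Scheme.{u}) [IsIntegral X] [IsLocallyNoetherian X]

/-- The principal divisors `div g`, for `g` a nonzero rational function. -/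
def principalDivisors : AddSubgroup (WeilDivisor X) where
  carrier := {D | ∃ g : X.functionField, g ≠ 0 ∧ ∀ E : PrimeDivisor X, D E = Scheme.ord g E.1}
  zero_mem' := by
    refine ⟨1, one_ne_zero, fun E => ?_⟩
    have h := Scheme.ord_mul (x := E.1) (f := (1 : X.functionField)) (g := 1)
      one_ne_zero one_ne_zero
    rw [mul_one] at h
    simp only [Finsupp.coe_zero, Pi.zero_apply]
    omega
  add_mem' := by
    rintro D D' ⟨g, hg, h⟩ ⟨g', hg', h'⟩
    refine ⟨g * g', mul_ne_zero hg hg', fun E => ?_⟩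
    rw [Finsupp.add_apply, h, h', Scheme.ord_mul hg hg']
  neg_mem' := by
    rintro D ⟨g, hg, h⟩
    refine ⟨g⁻¹, inv_ne_zero hg, fun E => ?_⟩
    have h1 := Scheme.ord_mul (x := E.1) (f := (1 : X.functionField)) (g := 1)
      one_ne_zero one_ne_zero
    have h2 := Scheme.ord_mul (x := E.1) hg (inv_ne_zero hg)
    rw [mul_one] at h1
    rw [mul_inv_cancel₀ hg] at h2
    rw [Finsupp.neg_apply, h]
    omega

/-- The divisor class group `Cl(X)` of a Noetherian integral scheme: Weil divisors modulo
principal divisors. -/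
abbrev Cl : Type u := WeilDivisor X ⧸ principalDivisors X

variable {X}

/-- The class of a prime divisor in `Cl(X)`. -/
def PrimeDivisor.cl (E : PrimeDivisor X) : Cl X :=
  QuotientAddGroup.mk (Finsupp.single E 1)

end ClassGroup

/-! ### The Picard group

`Pic X` is the group of isomorphism classes of line bundles on `X`, a line bundle being given by
its transition functions on an open cover. The covers are indexed by the points of `X` itself, which
is no restriction since every open cover has such a refinement. -/

section Picard

variable {X : Scheme.{u}}

/-- Restriction of invertible functions. -/
def resU {U V : X.Opens} (h : V ≤ U) : Γ(X, U)ˣ →* Γ(X, V)ˣ :=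
  Units.map (X.presheaf.map (homOfLE h).op).hom.toMonoidHom

/-- The germ of an invertible function. -/
def germU {U : X.Opens} {w : X} (hw : w ∈ U) : Γ(X, U)ˣ →* (X.presheaf.stalk w)ˣ :=
  Units.map (X.presheaf.germ U w hw).hom.toMonoidHom

theorem germU_resU {U V : X.Opens} (h : V ≤ U) {w : X} (hw : w ∈ V) (s : Γ(X, U)ˣ) :
    germU hw (resU h s) = germU (h hw) s := by
  ext
  exact TopCat.Presheaf.germ_res_apply X.presheaf (homOfLE h) w hw s.1

theorem mem_inf' {U V : X.Opens} {w : X} (hU : w ∈ U) (hV : w ∈ V) : w ∈ U ⊓ V := ⟨hU, hV⟩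

/-- The germ of an invertible function on an intersection of two open subsets. -/
def germI {U V : X.Opens} {w : X} (hU : w ∈ U) (hV : w ∈ V) :
    Γ(X, U ⊓ V)ˣ →* (X.presheaf.stalk w)ˣ :=
  germU (mem_inf' hU hV)

theorem germI_resU {U V U' V' : X.Opens} (h : U' ≤ U) (h' : V' ≤ V) {w : X} (hU : w ∈ U')
    (hV : w ∈ V') (s : Γ(X, U ⊓ V)ˣ) :
    germI hU hV (resU (inf_le_inf h h') s) = germI (h hU) (h' hV) s :=
  germU_resU _ _ _

variable (X) in
/-- The transition functions of a line bundle: an open neighbourhood `U x` of every point `x` and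
invertible functions `g x y` on `U x ∩ U y` with `g x y * g y z = g x z` on triple intersections.
The sections of the line bundle are the families of functions `s x` on `U x` with
`s x = g x y * s y`. -/
structure LineBundleCocycle where
  U : X → X.Opens
  mem : ∀ x, x ∈ U x
  g : ∀ x y, Γ(X, U x ⊓ U y)ˣ
  cocycle : ∀ (x y z w : X) (hx : w ∈ U x) (hy : w ∈ U y) (hz : w ∈ U z),
    germI hx hy (g x y) * germI hy hz (g y z) = germI hx hz (g x z)

namespace LineBundleCocycle

/-- Two systems of transition functions define isomorphic line bundles: there are invertible
functions `h x` near every point `x` with `g' x y * h y = h x * g x y`. -/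
def Equivalent (c c' : LineBundleCocycle X) : Prop :=
  ∃ (V : X → X.Opens) (_ : ∀ x, x ∈ V x) (hV : ∀ x, V x ≤ c.U x) (hV' : ∀ x, V x ≤ c'.U x)
    (h : ∀ x, Γ(X, V x)ˣ), ∀ (x y w : X) (hx : w ∈ V x) (hy : w ∈ V y),
      germI (hV' x hx) (hV' y hy) (c'.g x y) * germU hy (h y) =
        germU hx (h x) * germI (hV x hx) (hV y hy) (c.g x y)

theorem Equivalent.refl (c : LineBundleCocycle X) : Equivalent c c :=
  ⟨c.U, c.mem, fun _ => le_rfl, fun _ => le_rfl, fun _ => 1, fun x y w hx hy => by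
    rw [map_one, map_one, mul_one, one_mul]⟩

theorem Equivalent.symm {c c' : LineBundleCocycle X} (hc : Equivalent c c') :
    Equivalent c' c := by
  obtain ⟨V, mem, hV, hV', h, H⟩ := hc
  refine ⟨V, mem, hV', hV, fun x => (h x)⁻¹, fun x y w hx hy => ?_⟩
  rw [map_inv, map_inv, mul_inv_eq_iff_eq_mul, mul_assoc, H x y w hx hy, inv_mul_cancel_left]

theorem Equivalent.trans {c c' c'' : LineBundleCocycle X} (hc : Equivalent c c')
    (hc' : Equivalent c' c'') : Equivalent c c'' := by
  obtain ⟨V, mem, hV, hV', h, H⟩ := hc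
  obtain ⟨W, memW, hW, hW', k, K⟩ := hc'
  refine ⟨fun x => V x ⊓ W x, fun x => ⟨mem x, memW x⟩, fun x => inf_le_left.trans (hV x),
    fun x => inf_le_right.trans (hW' x),
    fun x => resU inf_le_right (k x) * resU inf_le_left (h x), fun x y w hx hy => ?_⟩
  have h1 := H x y w hx.1 hy.1
  have h2 := K x y w hx.2 hy.2
  rw [map_mul, map_mul, germU_resU, germU_resU, germU_resU, germU_resU, ← mul_assoc, h2,
    mul_assoc, h1, ← mul_assoc]

/-- The trivial line bundle. -/
protected def one : LineBundleCocycle X where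
  U := fun _ => ⊤
  mem := fun _ => trivial
  g := fun _ _ => 1
  cocycle := fun x y z w _ _ _ => by simp only [map_one, mul_one]

/-- The tensor product of two line bundles. -/
protected def mul (c d : LineBundleCocycle X) : LineBundleCocycle X where
  U := fun x => c.U x ⊓ d.U x
  mem := fun x => ⟨c.mem x, d.mem x⟩
  g := fun x y => resU (inf_le_inf inf_le_left inf_le_left) (c.g x y) *
    resU (inf_le_inf inf_le_right inf_le_right) (d.g x y)
  cocycle := fun x y z w hx hy hz => by
    have e : ∀ (a b : X) (ha : w ∈ c.U a ⊓ d.U a) (hb : w ∈ c.U b ⊓ d.U b),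
        germI ha hb (resU (inf_le_inf inf_le_left inf_le_left) (c.g a b) *
          resU (inf_le_inf inf_le_right inf_le_right) (d.g a b)) =
          germI ha.1 hb.1 (c.g a b) * germI ha.2 hb.2 (d.g a b) := fun a b ha hb =>
      (map_mul _ _ _).trans (congrArg₂ _ (germI_resU inf_le_left inf_le_left ha hb _)
        (germI_resU inf_le_right inf_le_right ha hb _))
    refine (congrArg₂ _ (e x y hx hy) (e y z hy hz)).trans (Eq.trans ?_ (e x z hx hz).symm)
    rw [mul_mul_mul_comm, c.cocycle x y z w, d.cocycle x y z w]

/-- The dual line bundle. -/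
protected def inv (c : LineBundleCocycle X) : LineBundleCocycle X where
  U := c.U
  mem := c.mem
  g := fun x y => (c.g x y)⁻¹
  cocycle := fun x y z w hx hy hz => by
    rw [map_inv, map_inv, map_inv, ← mul_inv, c.cocycle x y z w hx hy hz]

theorem germ_one {x y w : X} (hx : w ∈ (LineBundleCocycle.one (X := X)).U x)
    (hy : w ∈ (LineBundleCocycle.one (X := X)).U y) :
    germI hx hy ((LineBundleCocycle.one (X := X)).g x y) = 1 :=
  map_one _

theorem germ_mul (c d : LineBundleCocycle X) {x y w : X} (hx : w ∈ (c.mul d).U x)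
    (hy : w ∈ (c.mul d).U y) :
    germI hx hy ((c.mul d).g x y) = germI hx.1 hy.1 (c.g x y) * germI hx.2 hy.2 (d.g x y) := by
  refine (map_mul (germI hx hy) _ _).trans ?_
  congr 1
  · exact germI_resU inf_le_left inf_le_left hx hy _
  · exact germI_resU inf_le_right inf_le_right hx hy _

theorem germ_inv (c : LineBundleCocycle X) {x y w : X} (hx : w ∈ c.inv.U x)
    (hy : w ∈ c.inv.U y) :
    germI hx hy (c.inv.g x y) = (germI (U := c.U x) (V := c.U y) hx hy (c.g x y))⁻¹ :=
  map_inv _ _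

theorem Equivalent.of_germ_eq {c d : LineBundleCocycle X}
    (H : ∀ (x y w : X) (hx : w ∈ c.U x) (hy : w ∈ c.U y) (hx' : w ∈ d.U x) (hy' : w ∈ d.U y),
      germI hx hy (c.g x y) = germI hx' hy' (d.g x y)) : Equivalent c d :=
  ⟨fun x => c.U x ⊓ d.U x, fun x => ⟨c.mem x, d.mem x⟩, fun _ => inf_le_left,
    fun _ => inf_le_right, fun _ => 1, fun x y w hx hy => by
      rw [map_one, map_one, mul_one, one_mul]
      exact (H x y w hx.1 hy.1 hx.2 hy.2).symm⟩

theorem Equivalent.mul {c c' d d' : LineBundleCocycle X} (hc : Equivalent c c')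
    (hd : Equivalent d d') : Equivalent (c.mul d) (c'.mul d') := by
  obtain ⟨V, mem, hV, hV', h, H⟩ := hc
  obtain ⟨W, memW, hW, hW', k, K⟩ := hd
  refine ⟨fun x => V x ⊓ W x, fun x => ⟨mem x, memW x⟩, fun x => inf_le_inf (hV x) (hW x),
    fun x => inf_le_inf (hV' x) (hW' x),
    fun x => resU inf_le_left (h x) * resU inf_le_right (k x), fun x y w hx hy => ?_⟩
  have h1 := H x y w hx.1 hy.1
  have h2 := K x y w hx.2 hy.2
  refine (congrArg (· * _) (germ_mul c' d' _ _)).trans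
    (Eq.trans ?_ (congrArg (_ * ·) (germ_mul c d _ _)).symm)
  simp only [map_mul, germU_resU]
  rw [mul_mul_mul_comm, h1, h2, mul_mul_mul_comm]

theorem Equivalent.inv {c c' : LineBundleCocycle X} (hc : Equivalent c c') :
    Equivalent c.inv c'.inv := by
  obtain ⟨V, mem, hV, hV', h, H⟩ := hc
  refine ⟨V, mem, hV, hV', fun x => (h x)⁻¹, fun x y w hx hy => ?_⟩
  refine (congrArg (· * _) (germ_inv c' _ _)).trans
    (Eq.trans ?_ (congrArg (_ * ·) (germ_inv c _ _)).symm)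
  simp only [map_inv]
  rw [← mul_inv, H x y w hx hy, mul_inv]

variable (X) in
/-- Isomorphism of line bundles given by transition functions. -/
def setoid : Setoid (LineBundleCocycle X) :=
  ⟨Equivalent, Equivalent.refl, Equivalent.symm, Equivalent.trans⟩

end LineBundleCocycle

variable (X) in
/-- The Picard group of `X`: isomorphism classes of line bundles. -/
def Pic : Type u := Quotient (LineBundleCocycle.setoid X)

namespace Pic

open LineBundleCocycle

/-- The isomorphism class of a line bundle. -/
def mk (c : LineBundleCocycle X) : Pic X := Quotient.mk (LineBundleCocycle.setoid X) c

theorem sound {c d : LineBundleCocycle X} (h : Equivalent c d) : mk c = mk d :=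
  Quotient.sound (s := LineBundleCocycle.setoid X) h

theorem ind {P : Pic X → Prop} (h : ∀ c, P (mk c)) (a : Pic X) : P a :=
  Quotient.inductionOn a h

instance : Mul (Pic X) :=
  ⟨Quotient.map₂ LineBundleCocycle.mul fun _ _ h _ _ h' => Equivalent.mul h h'⟩

instance : One (Pic X) := ⟨mk LineBundleCocycle.one⟩

instance : Inv (Pic X) := ⟨Quotient.map LineBundleCocycle.inv fun _ _ h => Equivalent.inv h⟩

theorem mk_mul (c d : LineBundleCocycle X) : mk c * mk d = mk (c.mul d) := rfl

theorem mk_inv (c : LineBundleCocycle X) : (mk c)⁻¹ = mk c.inv := rfl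

theorem mk_one : (1 : Pic X) = mk LineBundleCocycle.one := rfl

/-- The group structure: tensor product and dual of line bundles. -/
instance : CommGroup (Pic X) where
  mul_assoc a b c := by
    induction a using Pic.ind with | _ a => ?_
    induction b using Pic.ind with | _ b => ?_
    induction c using Pic.ind with | _ c => ?_
    rw [mk_mul, mk_mul, mk_mul, mk_mul]
    refine sound (Equivalent.of_germ_eq fun x y w hx hy hx' hy' => ?_)
    rw [germ_mul, germ_mul, germ_mul, germ_mul, mul_assoc]
  one_mul a := by
    induction a using Pic.ind with | _ a => ?_
    rw [mk_one, mk_mul]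
    refine sound (Equivalent.of_germ_eq fun x y w hx hy hx' hy' => ?_)
    rw [germ_mul, germ_one, one_mul]
  mul_one a := by
    induction a using Pic.ind with | _ a => ?_
    rw [mk_one, mk_mul]
    refine sound (Equivalent.of_germ_eq fun x y w hx hy hx' hy' => ?_)
    rw [germ_mul, germ_one, mul_one]
  inv_mul_cancel a := by
    induction a using Pic.ind with | _ a => ?_
    rw [mk_one, mk_inv, mk_mul]
    refine sound (Equivalent.of_germ_eq fun x y w hx hy hx' hy' => ?_)
    rw [germ_mul, germ_inv, germ_one, inv_mul_cancel]
  mul_comm a b := by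
    induction a using Pic.ind with | _ a => ?_
    induction b using Pic.ind with | _ b => ?_
    rw [mk_mul, mk_mul]
    refine sound (Equivalent.of_germ_eq fun x y w hx hy hx' hy' => ?_)
    rw [germ_mul, germ_mul, mul_comm]

/-- `L` is the class of the line bundle `𝒪_X(D)` of the divisor `D` on a normal integral
Noetherian scheme `X`: there are local equations `f x` of `D` (so `div (f x) = D` on `U x`), and `L`
has the transition functions `f x / f y`. If such an `L` exists it is unique; if `X` is locally
factorial, for example smooth over a field, it exists. -/
def IsClassOf [IsIntegral X] [IsLocallyNoetherian X] (L : Pic X) (D : WeilDivisor X) : Prop :=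
  ∃ c : LineBundleCocycle X, mk c = L ∧ ∃ f : X → X.functionFieldˣ,
    (∀ (x : X) (E : PrimeDivisor X), E.1 ∈ c.U x → Scheme.ord (f x : X.functionField) E.1 = D E) ∧
    ∀ (x y w : X) (hx : w ∈ c.U x) (hy : w ∈ c.U y),
      algebraMap (X.presheaf.stalk w) X.functionField (germI hx hy (c.g x y)).1 =
        (f x : X.functionField) / (f y : X.functionField)

end Pic

end Picard

/-! ### Torsors under abelian varieties and their quotients -/

section Kummer

open MonoidalCategory CartesianMonoidalCategory MonObj

/-- The quotient of a scheme `Y` by the group generated by an automorphism `ζ` of finite order: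
`q : Y ⟶ Q` is affine and `ζ`-invariant, and the functions on an open subset `U` of `Q` are the
`ζ`-invariant functions on its preimage (so `Q` is locally the spectrum of a ring of invariants). -/
structure IsQuotientBy {Y Q : Scheme.{u}} (ζ : Y ⟶ Y) (q : Y ⟶ Q) : Prop where
  isAffineHom : IsAffineHom q
  comm : ζ ≫ q = q
  injective : ∀ U : Q.Opens, Function.Injective (q.app U)
  mem_range_iff : ∀ (U : Q.Opens) (h : q ⁻¹ᵁ U ≤ ζ ⁻¹ᵁ (q ⁻¹ᵁ U)) (s : Γ(Y, q ⁻¹ᵁ U)),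
    s ∈ Set.range (q.app U) ↔ ζ.appLE (q ⁻¹ᵁ U) (q ⁻¹ᵁ U) h s = s

variable {k : Type u} [Field k]

variable (k) in
/-- The spectrum of an algebraic closure of `k`. Morphisms `geomPt k ⟶ Y` over `k` are the geometric
points of `Y`. -/
def geomPt : Over (Spec (.of k)) :=
  Over.mk (Spec.map (CommRingCat.ofHom (algebraMap k (AlgebraicClosure k))))

/-- The action of the absolute Galois group on the spectrum of the algebraic closure. -/
def galoisMap (τ : AlgebraicClosure k ≃ₐ[k] AlgebraicClosure k) : geomPt k ⟶ geomPt k :=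
  Over.homMk (Spec.map (CommRingCat.ofHom (τ : AlgebraicClosure k →+* AlgebraicClosure k))) (by
    dsimp [geomPt]
    rw [← Spec.map_comp, ← CommRingCat.ofHom_comp]
    congr 2
    ext x
    exact τ.commutes x)

/-- `A` is an abelian variety of dimension `d`: a proper, smooth, geometrically integral group
scheme of dimension `d` over `k`. -/
structure IsAbelianVariety (A : Over (Spec (.of k))) [GrpObj A] (d : ℕ) : Prop where
  isProper : IsProper A.hom
  smooth : SmoothOfRelativeDimension d A.hom
  geometricallyIntegral : GeometricallyIntegral A.hom

/-- The action of the group `A` on `Y`, as a morphism `A × Y ⟶ Y`. -/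
abbrev act (A Y : Over (Spec (.of k))) [MonObj A] [ModObj A Y] : A ⊗ Y ⟶ Y :=
  ModObj.smul (M := A) (X := Y)

/-- `Y` is a torsor (principal homogeneous space) of `A`: a smooth variety with a simply transitive
action of `A`. -/
structure IsTorsor (A Y : Over (Spec (.of k))) [MonObj A] [ModObj A Y] : Prop where
  smooth : Smooth Y.hom
  isSeparated : IsSeparated Y.hom
  quasiCompact : QuasiCompact Y.hom
  geometricallyIntegral : GeometricallyIntegral Y.hom
  isIso_shear : IsIso (lift (act A Y) (snd A Y))

/-- Let `T` be the group of fixed points of `ζ` on `A`. The class of the torsor `Y` in `H¹(k, A)`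
comes from `H¹(k, T)`, as there is a geometric point `y` of `Y` such that every Galois conjugate of
`y` differs from `y` by an element of `T`; and `ζY` is the automorphism of `Y` over `k` induced by
`ζ`, that is `ζY (a • y) = ζ a • y`. -/
structure IsTwistByFixedPoints {A Y : Over (Spec (.of k))} [MonObj A] [ModObj A Y]
    (ζ : A ⟶ A) (ζY : Y ⟶ Y) : Prop where
  compatible : (ζ ⊗ₘ ζY) ≫ act A Y = act A Y ≫ ζY
  exists_point : ∃ y : geomPt k ⟶ Y, y ≫ ζY = y ∧
    ∀ τ : AlgebraicClosure k ≃ₐ[k] AlgebraicClosure k,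
      ∃ t : geomPt k ⟶ A, t ≫ ζ = t ∧ galoisMap τ ≫ y = lift t y ≫ act A Y

instance isLocallyNoetherian_of_smooth (X : Over (Spec (.of k))) [Smooth X.hom] :
    IsLocallyNoetherian X.left :=
  have : IsNoetherianRing (CommRingCat.of k) := inferInstanceAs (IsNoetherianRing k)
  LocallyOfFiniteType.isLocallyNoetherian X.hom

end Kummer

end ExcDiv

end

/-!
A relation `∑ nᵢ Eᵢ ∼ 0` between exceptional divisors of a proper birational morphism `f : X ⟶ Y` is
a rational function `g` on `X` with `div g = ∑ nᵢ Eᵢ`. As `f` is birational, `g` is a rational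
function on `Y`. Let `y` be a point of codimension one of `Y`. As `Y` is normal, the local ring at
`y` is a discrete valuation ring, and by the valuative criterion of properness there is a point `x`
of `X` over `y` with the same local ring (`IsBirationalMorphism.exists_stalkMap_surjective`). The
point `x` is a prime divisor and not exceptional, so `g` has order zero at `x`, and `g` is a unit at
`y`. A function that is regular in codimension one on a normal Noetherian scheme is regular
(`mem_range_of_forall_height_eq_one`), so `g` and `g⁻¹` are regular on `Y`, and `div g = 0` on `X`
(`IsBirationalMorphism.ord_eq_zero`). Hence all `nᵢ` vanish.

For the classes in the Picard group the same argument applies, because a divisor whose line bundle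
is trivial is principal (`Pic.IsClassOf.mem_principalDivisors`). Both cases are instances of
`IsBirationalMorphism.linearIndependent`.

For a quotient `Y / ⟨ζ⟩` of a torsor it remains to see that the quotient is integral, normal and
locally Noetherian. The torsor `Y` is smooth over `k`, so it is normal
(`isNormalScheme_of_smooth_field`): it is locally étale over an affine space. Functions on the
quotient are invariant functions on `Y`. Rings of invariants of normal domains are normal domains,
and they are Noetherian by the Artin–Tate lemma if the automorphism has finite order. The
automorphism of `Y` has finite order because over the algebraic closure of `k` the orbit map of a
fixed point identifies it with `ζ` (`IsTwistByFixedPoints.pow_eq_one`).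
-/

noncomputable section

namespace ExcDiv

/-! ### Intersections of localizations at primes of height one -/

section Hartogs

variable {R K : Type*} [CommRing R] [Field K] [Algebra R K] [IsFractionRing R K]

/-- If `y` is not in `R` but `y 𝔪` is contained in `R`, then `𝔪` is principal: otherwise `y 𝔪` is
contained in `𝔪`, so that `y` is integral over `R`. -/
theorem isPrincipal_maximalIdeal_of_mul_mem [IsLocalRing R] [IsNoetherianRing R]
    [IsIntegrallyClosed R] {y : K} (hy : y ∉ (algebraMap R K).range)
    (h : ∀ p ∈ IsLocalRing.maximalIdeal R, y * algebraMap R K p ∈ (algebraMap R K).range) :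
    (IsLocalRing.maximalIdeal R).IsPrincipal := by
  have inj := IsFractionRing.injective R K
  by_cases hu : ∃ p ∈ IsLocalRing.maximalIdeal R, ∃ u : R, IsUnit u ∧
      algebraMap R K u = y * algebraMap R K p
  -- if `y p = u` is a unit, then `q = u⁻¹ (y q) p` for all `q` in the maximal ideal
  · obtain ⟨p, hp, u, hu, e⟩ := hu
    refine ⟨⟨p, le_antisymm (fun q hq => ?_) ?_⟩⟩
    · obtain ⟨c, hc⟩ := h q hq
      obtain ⟨v, hv⟩ := hu.exists_right_inv
      refine Ideal.mem_span_singleton'.mpr ⟨v * c, inj ?_⟩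
      have hv' : algebraMap R K u * algebraMap R K v = 1 := by rw [← map_mul, hv, map_one]
      rw [map_mul, map_mul, hc]
      rw [e] at hv'
      linear_combination algebraMap R K q * hv'
    · rw [Ideal.submodule_span_eq, Ideal.span_singleton_le_iff_mem]
      exact hp
  · exfalso
    refine hy ?_
    have hint : IsIntegral R y := by
      let N : Submodule R K := Submodule.map (Algebra.linearMap R K) (IsLocalRing.maximalIdeal R)
      refine isIntegral_of_smul_mem_submodule (N := N) (M := K) ?_ ?_ y ?_
      -- if the maximal ideal is zero, then `R` is a field and contains `y`
      · intro hN
        have hbot : IsLocalRing.maximalIdeal R = ⊥ := by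
          exact Submodule.map_injective_of_injective (f := Algebra.linearMap R K) inj
            (hN.trans (Submodule.map_bot _).symm)
        have hf := IsLocalRing.isField_iff_maximalIdeal_eq.mpr hbot
        obtain ⟨a, b, hb, rfl⟩ := IsFractionRing.div_surjective (A := R) y
        obtain ⟨c, hc⟩ := hf.mul_inv_cancel (nonZeroDivisors.ne_zero hb)
        refine hy ⟨a * c, ?_⟩
        have hb0 : algebraMap R K b ≠ 0 := by
          simpa using nonZeroDivisors.ne_zero hb
        rw [eq_div_iff hb0, ← map_mul]
        congr 1
        linear_combination a * hc
      · exact (IsNoetherian.noetherian _).map _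
      · rintro _ ⟨p, hp, rfl⟩
        obtain ⟨c, hc⟩ := h p hp
        refine ⟨c, ?_, hc⟩
        by_contra hcu
        exact hu ⟨p, hp, c, by simpa using hcu, hc⟩
    exact IsIntegrallyClosed.isIntegral_iff.mp hint

/-- Algebraic Hartogs: a Noetherian integrally closed domain is the intersection of its
localizations at the primes of height one. -/
theorem mem_range_of_forall_height_eq_one [IsDomain R] [IsNoetherianRing R]
    [IsIntegrallyClosed R] (x : K)
    (h : ∀ (P : Ideal R) [P.IsPrime], P.height = 1 →
      ∃ s ∉ P, algebraMap R K s * x ∈ (algebraMap R K).range) :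
    x ∈ (algebraMap R K).range := by
  by_contra hx
  -- `P` is an associated prime of `K / R` containing the denominator ideal of `x`; its height is
  -- one, since the maximal ideal of the localization at `P` is principal
  let N : Submodule R K := LinearMap.range (Algebra.linearMap R K)
  have hx0 : N.mkQ x ≠ 0 := fun h0 => hx ((Submodule.Quotient.mk_eq_zero N).mp h0)
  obtain ⟨P, hP, hle⟩ := exists_le_isAssociatedPrime_of_isNoetherianRing R _ hx0
  obtain ⟨hPp, y, hy⟩ := isAssociatedPrime_iff.mp hP
  obtain ⟨y, rfl⟩ := N.mkQ_surjective y
  have hPy : ∀ s : R, s ∈ P ↔ algebraMap R K s * y ∈ (algebraMap R K).range := fun s => by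
    rw [hy, Submodule.mem_colon_singleton, ← map_smul, Submodule.mem_bot, Submodule.mkQ_apply,
      Submodule.Quotient.mk_eq_zero, Algebra.smul_def]
    rfl
  have hxP : ∀ s : R, algebraMap R K s * x ∈ (algebraMap R K).range → s ∈ P := fun s hs => by
    refine hle ?_
    rw [Submodule.mem_colon_singleton, ← map_smul, Submodule.mem_bot, Submodule.mkQ_apply,
      Submodule.Quotient.mk_eq_zero, Algebra.smul_def]
    exact hs
  let A := Localization.subalgebra.ofField K P.primeCompl P.primeCompl_le_nonZeroDivisors
  have hloc : IsLocalization.AtPrime A P :=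
    Localization.subalgebra.isLocalization_ofField K P.primeCompl _
  have hlocal : IsLocalRing A := IsLocalization.AtPrime.isLocalRing A P
  have hnoeth : IsNoetherianRing A := IsLocalization.isNoetherianRing P.primeCompl A inferInstance
  have hic : IsIntegrallyClosed A :=
    isIntegrallyClosed_of_isLocalization A P.primeCompl P.primeCompl_le_nonZeroDivisors
  have hprin : (IsLocalRing.maximalIdeal A).IsPrincipal := by
    refine isPrincipal_maximalIdeal_of_mul_mem (R := A) (K := K) (y := y) ?_ ?_
    · rintro ⟨⟨_, a, s, hs, rfl⟩, h⟩
      refine hs ((hPy s).mpr ⟨a, ?_⟩)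
      have hs0 : algebraMap R K s ≠ 0 := by
        simpa using fun h0 : s = 0 => hs (h0 ▸ P.zero_mem)
      rw [← h]
      change _ = algebraMap R K s * (algebraMap R K a * (algebraMap R K s)⁻¹)
      field_simp
    · intro p hp
      obtain ⟨q, s, e⟩ := IsLocalization.exists_mk'_eq P.primeCompl p
      subst e
      have hq : q ∈ P := (IsLocalization.AtPrime.mk'_mem_maximal_iff A P q s).mp hp
      obtain ⟨c, hc⟩ := (hPy q).mp hq
      refine ⟨IsLocalization.mk' A c s, ?_⟩
      have hs0 : algebraMap R K s ≠ 0 := by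
        simpa using fun h0 : (s : R) = 0 => s.2 (h0 ▸ P.zero_mem)
      have key : ∀ r : R, algebraMap A K (IsLocalization.mk' A r s) * algebraMap R K s =
          algebraMap R K r := fun r => by
        rw [IsScalarTower.algebraMap_apply R A K, ← map_mul, IsLocalization.mk'_spec,
          ← IsScalarTower.algebraMap_apply]
      refine mul_right_cancel₀ hs0 ?_
      rw [key, mul_assoc, key, hc, mul_comm]
  have hht : P.height = 1 := by
    have h1 : (IsLocalRing.maximalIdeal A).height ≤ 1 :=
      Ideal.height_le_one_of_isPrincipal_of_mem_minimalPrimes (IsLocalRing.maximalIdeal A) _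
        (by rw [Ideal.minimalPrimes_eq_subsingleton_self]; rfl)
    rw [← IsLocalization.height_under P.primeCompl,
      IsLocalization.AtPrime.under_maximalIdeal A P] at h1
    refine le_antisymm h1 (Order.one_le_iff_ne_zero.mpr fun h0 => ?_)
    rw [Ideal.height_eq_zero_iff_eq_bot] at h0
    obtain ⟨a, b, hb, rfl⟩ := IsFractionRing.div_surjective (A := R) y
    have hb0 : algebraMap R K b ≠ 0 := by simpa using nonZeroDivisors.ne_zero hb
    have hbP : b ∈ P := (hPy b).mpr ⟨a, by field_simp⟩
    rw [h0, Ideal.mem_bot] at hbP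
    exact nonZeroDivisors.ne_zero hb hbP
  obtain ⟨s, hs, h⟩ := h P hht
  exact hs (hxP s h)

end Hartogs

/-! ### Smooth algebras over a field are normal -/

section Smooth

open TensorProduct

/-- A domain étale over a normal domain is normal: with `K = Frac R`, the ring `S ⊗ K` is finite
étale over `K`, hence the fraction field of `S`, and the integral closure of `S` in it is
`S ⊗ R = S`, as integral closures commute with smooth base change. -/
theorem isIntegrallyClosed_of_etale (R S : Type*) [CommRing R] [IsDomain R] [IsIntegrallyClosed R]
    [CommRing S] [IsDomain S] [Algebra R S] [Algebra.Etale R S] : IsIntegrallyClosed S := by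
  let K := FractionRing R
  let T := S ⊗[R] K
  have hflat : Module.Flat R S := inferInstance
  have hinj : Function.Injective (algebraMap R S) :=
    FaithfulSMul.algebraMap_injective R S
  have hM : Algebra.algebraMapSubmonoid S (nonZeroDivisors R) ≤ nonZeroDivisors S := by
    rintro _ ⟨r, hr, rfl⟩
    exact mem_nonZeroDivisors_of_ne_zero ((map_ne_zero_iff _ hinj).mpr (nonZeroDivisors.ne_zero hr))
  have hdom : IsDomain T := IsLocalization.isDomain_of_le_nonZeroDivisors _ hM
  have hST : Function.Injective (algebraMap S T) := IsLocalization.injective T hM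
  have hdom' : IsDomain (K ⊗[R] S) :=
    (Algebra.TensorProduct.comm R K S).toMulEquiv.isDomain _
  have hfin : Module.Finite K (K ⊗[R] S) := Algebra.FormallyUnramified.finite_of_free K _
  have hfld' : IsField (K ⊗[R] S) :=
    isField_of_isIntegral_of_isField' (R := K) (Field.toIsField K)
  have hfld : IsField T :=
    (Algebra.TensorProduct.comm R S K).toRingEquiv.toMulEquiv.isField hfld'
  let _ : Field T := hfld.toField
  have hfrac : IsFractionRing S T := by
    have : FaithfulSMul S T := (faithfulSMul_iff_algebraMap_injective S T).mpr hST
    refine IsFractionRing.of_field S T fun z => ?_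
    obtain ⟨a, m, e⟩ := IsLocalization.exists_mk'_eq
      (Algebra.algebraMapSubmonoid S (nonZeroDivisors R)) z
    refine ⟨a, m, ?_⟩
    rw [← e, eq_div_iff, IsLocalization.mk'_spec]
    exact (map_ne_zero_iff _ hST).mpr (nonZeroDivisors.ne_zero (hM m.2))
  refine (isIntegrallyClosed_iff T).mpr fun {x} hx => ?_
  obtain ⟨z, hz⟩ := (TensorProduct.toIntegralClosure_bijective_of_smooth (R := R) (S := S)
    (B := K)).2 ⟨x, hx⟩
  have hz' : Algebra.TensorProduct.map (.id S S) (integralClosure R K).val z = x :=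
    congrArg Subtype.val hz
  rw [← hz']
  clear hz hz' hx
  induction z with
  | zero => exact ⟨0, by simp⟩
  | add a b ha hb =>
    obtain ⟨a', ha⟩ := ha
    obtain ⟨b', hb⟩ := hb
    exact ⟨a' + b', by rw [map_add, map_add, ha, hb]⟩
  | tmul s b =>
    obtain ⟨r, hr⟩ := IsIntegrallyClosed.isIntegral_iff.mp b.2
    refine ⟨r • s, ?_⟩
    simp only [Algebra.TensorProduct.map_tmul, AlgHom.coe_id, id, Subalgebra.coe_val, ← hr]
    rw [Algebra.algebraMap_eq_smul_one r, TensorProduct.tmul_smul, TensorProduct.smul_tmul']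
    exact Algebra.TensorProduct.algebraMap_apply _

/-- The local rings of a smooth domain over a field are normal, because the domain is locally étale
over a polynomial ring. -/
theorem isIntegrallyClosed_atPrime_of_smooth_field (k S T : Type*) [Field k] [CommRing S]
    [IsDomain S] [Algebra k S] [Algebra.Smooth k S] (P : Ideal S) [P.IsPrime] [CommRing T]
    [Algebra S T] [IsLocalization.AtPrime T P] : IsIntegrallyClosed T := by
  obtain ⟨f, hf, n, _, _, _⟩ :=
    Algebra.IsSmoothAt.exists_isStandardEtale_mvPolynomial (R := k) (p := P)
  have hM : Submonoid.powers f ≤ nonZeroDivisors S :=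
    powers_le_nonZeroDivisors_of_noZeroDivisors fun h => hf (h ▸ P.zero_mem)
  have hdom : IsDomain (Localization.Away f) := IsLocalization.isDomain_localization hM
  have := isIntegrallyClosed_of_etale (MvPolynomial (Fin n) k) (Localization.Away f)
  have hle : Submonoid.powers f ≤ P.primeCompl := by
    rw [Submonoid.powers_le]
    exact hf
  let _ : Algebra (Localization.Away f) T :=
    IsLocalization.localizationAlgebraOfSubmonoidLe _ T (Submonoid.powers f) P.primeCompl hle
  have : IsScalarTower S (Localization.Away f) T :=
    IsLocalization.localization_isScalarTower_of_submonoid_le _ T (Submonoid.powers f)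
      P.primeCompl hle
  have hloc := IsLocalization.isLocalization_of_submonoid_le (Localization.Away f) T
    (Submonoid.powers f) P.primeCompl hle
  refine isIntegrallyClosed_of_isLocalization T
    (P.primeCompl.map (algebraMap S (Localization.Away f))) ?_
  rintro _ ⟨s, hs, rfl⟩
  refine mem_nonZeroDivisors_of_ne_zero ((map_ne_zero_iff _ (IsLocalization.injective _ hM)).mpr ?_)
  rintro rfl
  exact hs P.zero_mem

end Smooth

/-! ### Normal schemes and orders of rational functions -/

section Normal

variable {X : Scheme.{u}} [IsIntegral X]

theorem isIntegrallyClosed_section (hX : IsNormalScheme X) {U : X.Opens} (hU : IsAffineOpen U)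
    [Nonempty U] : IsIntegrallyClosed Γ(X, U) := by
  refine IsIntegrallyClosed.of_localization_maximal fun P _ hP => ?_
  have hy : hU.fromSpec ⟨P, hP.isPrime⟩ ∈ U := (hU.isoSpec.inv _).2
  let _ : Algebra Γ(X, U) (X.presheaf.stalk (hU.fromSpec ⟨P, hP.isPrime⟩)) :=
    TopCat.Presheaf.algebra_section_stalk X.presheaf ⟨_, hy⟩
  have hloc : IsLocalization.AtPrime (X.presheaf.stalk (hU.fromSpec ⟨P, hP.isPrime⟩)) P :=
    hU.isLocalization_stalk' ⟨P, hP.isPrime⟩ hy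
  have := hX (hU.fromSpec ⟨P, hP.isPrime⟩)
  exact IsIntegrallyClosed.of_equiv
    (IsLocalization.algEquiv P.primeCompl (X.presheaf.stalk (hU.fromSpec ⟨P, hP.isPrime⟩))
      (Localization.AtPrime P)).toRingEquiv

theorem isNormalScheme_of_forall_isIntegrallyClosed
    (h : ∀ U : X.Opens, IsAffineOpen U → Nonempty U → IsIntegrallyClosed Γ(X, U)) :
    IsNormalScheme X := fun x => by
  obtain ⟨_, ⟨U, hU, rfl⟩, hxU, -⟩ := X.isBasis_affineOpens.exists_subset_of_mem_open
    (Set.mem_univ x) isOpen_univ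
  have : Nonempty U := ⟨⟨x, hxU⟩⟩
  have := h U hU inferInstance
  let _ : Algebra Γ(X, U) (X.presheaf.stalk x) :=
    TopCat.Presheaf.algebra_section_stalk X.presheaf ⟨x, hxU⟩
  have hloc : IsLocalization.AtPrime (X.presheaf.stalk x) (hU.primeIdealOf ⟨x, hxU⟩).asIdeal :=
    hU.isLocalization_stalk ⟨x, hxU⟩
  exact isIntegrallyClosed_of_isLocalization _ (hU.primeIdealOf ⟨x, hxU⟩).asIdeal.primeCompl
    (Ideal.primeCompl_le_nonZeroDivisors _)

theorem isNormalScheme_of_smooth_field {k : Type u} [Field k] (f : X ⟶ Spec (.of k)) [Smooth f] :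
    IsNormalScheme X := fun x => by
  obtain ⟨_, ⟨U, hU, rfl⟩, hxU, -⟩ := X.isBasis_affineOpens.exists_subset_of_mem_open
    (Set.mem_univ x) isOpen_univ
  have : Nonempty U := ⟨⟨x, hxU⟩⟩
  let _ : Algebra Γ(X, U) (X.presheaf.stalk x) :=
    TopCat.Presheaf.algebra_section_stalk X.presheaf ⟨x, hxU⟩
  have hloc : IsLocalization.AtPrime (X.presheaf.stalk x) (hU.primeIdealOf ⟨x, hxU⟩).asIdeal :=
    hU.isLocalization_stalk ⟨x, hxU⟩
  have hs : (f.appLE ⊤ U le_top).hom.Smooth := f.smooth_appLE (isAffineOpen_top _) hU le_top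
  have hs' : ((f.appLE ⊤ U le_top).hom.comp (Scheme.ΓSpecIso (.of k)).inv.hom).Smooth :=
    (RingHom.Smooth.of_bijective
      (ConcreteCategory.bijective_of_isIso (Scheme.ΓSpecIso (.of k)).inv)).comp hs
  algebraize [(f.appLE ⊤ U le_top).hom.comp (Scheme.ΓSpecIso (.of k)).inv.hom]
  exact isIntegrallyClosed_atPrime_of_smooth_field k Γ(X, U) _
    (hU.primeIdealOf ⟨x, hxU⟩).asIdeal

variable [IsLocallyNoetherian X]

/-- On a locally Noetherian normal scheme, a rational function that is regular in codimension one is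
regular. -/
theorem mem_range_stalk_of_forall_coheight_eq_one (hX : IsNormalScheme X) (g : X.functionField)
    (h : ∀ y : X, coheight y = 1 → g ∈ (algebraMap (X.presheaf.stalk y) X.functionField).range)
    (x : X) : g ∈ (algebraMap (X.presheaf.stalk x) X.functionField).range := by
  obtain ⟨_, ⟨U, hU, rfl⟩, hxU, -⟩ := X.isBasis_affineOpens.exists_subset_of_mem_open
    (Set.mem_univ x) isOpen_univ
  have : Nonempty U := ⟨⟨x, hxU⟩⟩
  have hfrac := functionField_isFractionRing_of_isAffineOpen X U hU
  have hnoeth : IsNoetherianRing Γ(X, U) := IsLocallyNoetherian.component_noetherian ⟨U, hU⟩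
  have hic := isIntegrallyClosed_section hX hU
  have key : g ∈ (algebraMap Γ(X, U) X.functionField).range := by
    refine mem_range_of_forall_height_eq_one g fun P hP hP1 => ?_
    have hy : hU.fromSpec ⟨P, hP⟩ ∈ U := (hU.isoSpec.inv _).2
    let y := hU.fromSpec ⟨P, hP⟩
    let _ : Algebra Γ(X, U) (X.presheaf.stalk y) :=
      TopCat.Presheaf.algebra_section_stalk X.presheaf ⟨y, hy⟩
    have hloc : IsLocalization.AtPrime (X.presheaf.stalk y) P :=
      hU.isLocalization_stalk' ⟨P, hP⟩ hy
    have htower := functionField_isScalarTower X U ⟨y, hy⟩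
    have hy1 : coheight y = 1 := by
      have := ringKrullDim_stalk_eq_coheight y
      rw [IsLocalization.AtPrime.ringKrullDim_eq_height P, hP1] at this
      exact_mod_cast this.symm
    obtain ⟨a, rfl⟩ := h y hy1
    obtain ⟨b, s, rfl⟩ := IsLocalization.exists_mk'_eq P.primeCompl a
    refine ⟨s, s.2, b, ?_⟩
    rw [IsScalarTower.algebraMap_apply Γ(X, U) (X.presheaf.stalk y),
      IsScalarTower.algebraMap_apply Γ(X, U) (X.presheaf.stalk y) _ (s : Γ(X, U)), ← map_mul,
      IsLocalization.mk'_spec']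
  obtain ⟨c, rfl⟩ := key
  exact ⟨X.presheaf.germ U x hxU c, Scheme.algebraMap_germ_eq_germToFunctionField _ hxU c⟩

theorem isDiscreteValuationRing_stalk (hX : IsNormalScheme X) {x : X} (hx : coheight x = 1) :
    IsDiscreteValuationRing (X.presheaf.stalk x) := by
  have hdim := ringKrullDim_stalk_eq_coheight x
  rw [hx] at hdim
  have hic := hX x
  have hnf : ¬ IsField (X.presheaf.stalk x) := fun hf => by
    rw [ringKrullDim_eq_zero_of_isField hf] at hdim
    exact absurd hdim (by norm_num)
  have hle : Ring.KrullDimLE 1 (X.presheaf.stalk x) := krullDimLE_of_coheight_le hx.le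
  have hded : IsDedekindDomain (X.presheaf.stalk x) :=
    { maximalOfPrime := fun {p} hp hpp =>
        Ring.krullDimLE_one_iff_of_isPrime_bot.mp hle p hp hpp
      toIsIntegralClosure := (isIntegrallyClosed_iff_isIntegralClosure (FractionRing _)).mp hic }
  exact ((IsDiscreteValuationRing.TFAE _ hnf).out 0 2).mpr hded

/-- A rational function of order zero at a point whose local ring is a discrete valuation ring is
regular there. -/
theorem mem_range_stalk_of_ord_eq_zero {x : X} [IsDiscreteValuationRing (X.presheaf.stalk x)]
    (hx : coheight x = 1) {g : X.functionField} (hg : g ≠ 0) (h : Scheme.ord g x = 0) :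
    g ∈ (algebraMap (X.presheaf.stalk x) X.functionField).range := by
  rw [Scheme.ord_eq_iff hx hg] at h
  have h : Ring.ordFrac (X.presheaf.stalk x) g = 1 := h
  have hm : g ∈ MonoidHom.mker (Ring.ordFrac (X.presheaf.stalk x) (K := X.functionField)) := h
  rw [Ring.mker_ordFrac_eq_isUnitSubmonoid] at hm
  obtain ⟨a, -, ha⟩ := hm
  exact ⟨a, ha⟩

/-- An invertible germ has order zero; at a point whose codimension is not one, `Scheme.ord` is zero
by convention. -/
theorem ord_algebraMap_of_isUnit {x : X} {a : X.presheaf.stalk x} (ha : IsUnit a) :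
    Scheme.ord (algebraMap (X.presheaf.stalk x) X.functionField a) x = 0 := by
  by_cases hx : coheight x = 1
  · have : Ring.KrullDimLE 1 (X.presheaf.stalk x) := krullDimLE_of_coheight_le hx.le
    rw [Scheme.ord_eq_iff hx (ha.map _).ne_zero]
    exact Ring.ordFrac_of_isUnit ha
  · exact Scheme.ord_eq_zero_of_coheight_neq_one hx _

theorem ord_one (x : X) : Scheme.ord (1 : X.functionField) x = 0 := by
  rw [← map_one (algebraMap (X.presheaf.stalk x) X.functionField)]
  exact ord_algebraMap_of_isUnit isUnit_one

theorem ord_inv {g : X.functionField} (hg : g ≠ 0) (x : X) :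
    Scheme.ord g⁻¹ x = - Scheme.ord g x := by
  have := Scheme.ord_mul (x := x) hg (inv_ne_zero hg)
  rw [mul_inv_cancel₀ hg, ord_one] at this
  omega

end Normal

/-! ### Proper birational morphisms -/

section Birational

variable {X Y : Scheme.{u}} [IsIntegral X] [IsIntegral Y] (f : X ⟶ Y)

/-- The map of function fields `K(Y) → K(X)` induced by a morphism `f : X ⟶ Y` that maps the generic
point of `X` to the generic point of `Y`. -/
def functionFieldMap (h : f (genericPoint X) = genericPoint Y) :
    Y.functionField ⟶ X.functionField :=
  Y.presheaf.stalkSpecializes (specializes_of_eq h) ≫ f.stalkMap (genericPoint X)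

theorem functionFieldMap_algebraMap (h : f (genericPoint X) = genericPoint Y) (x : X)
    (a : Y.presheaf.stalk (f x)) :
    functionFieldMap f h (algebraMap _ _ a) = algebraMap _ _ (f.stalkMap x a) := by
  have hx : genericPoint X ⤳ x := (genericPoint_spec X).specializes trivial
  have hy : genericPoint Y ⤳ f x := (genericPoint_spec Y).specializes trivial
  have e : Y.presheaf.stalkSpecializes hy ≫
      (Y.presheaf.stalkSpecializes (specializes_of_eq h) ≫ f.stalkMap (genericPoint X)) =
      f.stalkMap x ≫ X.presheaf.stalkSpecializes hx := by
    rw [← Scheme.Hom.stalkSpecializes_stalkMap, TopCat.Presheaf.stalkSpecializes_comp_assoc]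
  exact congr($e a)

variable {f}

theorem IsBirationalMorphism.map_genericPoint (hf : IsBirationalMorphism f) :
    f (genericPoint X) = genericPoint Y := by
  obtain ⟨φ, hφ⟩ := hf
  have : Nonempty φ.source := φ.dense_source.nonempty.to_subtype
  have h1 := genericPoint_eq_of_isOpenImmersion φ.source.ι
  have h2 := genericPoint_eq_of_isOpenImmersion (φ.iso.hom ≫ φ.target.ι)
  rw [hφ, Scheme.Hom.comp_apply, h1] at h2
  exact h2

theorem IsBirationalMorphism.bijective_functionFieldMap (hf : IsBirationalMorphism f) :
    Function.Bijective (functionFieldMap f hf.map_genericPoint) := by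
  have h0 := hf.map_genericPoint
  obtain ⟨φ, hφ⟩ := hf
  have : Nonempty φ.source := φ.dense_source.nonempty.to_subtype
  have h1 := genericPoint_eq_of_isOpenImmersion φ.source.ι
  have : IsOpenImmersion (φ.source.ι ≫ f) := hφ ▸ inferInstance
  have key : ∀ x : X, φ.source.ι (genericPoint φ.source) = x → IsIso (f.stalkMap x) := by
    rintro _ rfl
    have e := Scheme.Hom.stalkMap_comp φ.source.ι f (genericPoint φ.source)
    have hi : IsIso ((φ.source.ι ≫ f).stalkMap (genericPoint φ.source)) := inferInstance
    have hi : IsIso (f.stalkMap (φ.source.ι (genericPoint φ.source)) ≫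
        φ.source.ι.stalkMap (genericPoint φ.source)) := e ▸ hi
    exact IsIso.of_isIso_comp_right _ (φ.source.ι.stalkMap (genericPoint φ.source))
  have := key _ h1
  have : IsIso (Y.presheaf.stalkSpecializes (specializes_of_eq h0)) :=
    (Y.presheaf.stalkCongr (.of_eq h0.symm)).isIso_hom
  have : IsIso (functionFieldMap f h0) := by
    unfold functionFieldMap
    infer_instance
  exact ConcreteCategory.bijective_of_isIso (functionFieldMap f h0)

theorem specMap_functionFieldMap (h : f (genericPoint X) = genericPoint Y) {y : Y}
    (hy : genericPoint Y ⤳ y) :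
    X.fromSpecStalk (genericPoint X) ≫ f =
      Spec.map (Y.presheaf.stalkSpecializes hy ≫ functionFieldMap f h) ≫ Y.fromSpecStalk y := by
  rw [functionFieldMap, Spec.map_comp, Spec.map_comp, Category.assoc, Category.assoc,
    Scheme.SpecMap_stalkSpecializes_fromSpecStalk, Scheme.SpecMap_stalkSpecializes_fromSpecStalk,
    Scheme.SpecMap_stalkMap_fromSpecStalk]

/-- The existence part of the valuative criterion, for a fraction field `K` of the valuation ring
`R` that is given by a ring homomorphism `φ`. -/
theorem exists_lift_of_isProper {X Y : Scheme.{u}} (f : X ⟶ Y) [IsProper f] (R K : CommRingCat.{u})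
    [IsDomain R] [ValuationRing R] (hK : IsField K) (φ : R ⟶ K)
    (hφ : letI := φ.hom.toAlgebra; IsFractionRing R K) (i₁ : Spec K ⟶ X) (i₂ : Spec R ⟶ Y)
    (sq : i₁ ≫ f = Spec.map φ ≫ i₂) : ∃ l : Spec R ⟶ X, Spec.map φ ≫ l = i₁ ∧ l ≫ f = i₂ := by
  have hval : ValuativeCriterion.Existence f := by
    have : (@IsProper) f := ‹_›
    rw [IsProper.eq_valuativeCriterion] at this
    exact this.1.1.1.existence
  let _ : Field K := hK.toField
  let _ : Algebra R K := φ.hom.toAlgebra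
  have := hval
      { R := R
        K := K
        i₁ := i₁
        i₂ := i₂
        commSq := ⟨sq⟩ }
  exact ⟨_, this.exists_lift.some.fac_left, this.exists_lift.some.fac_right⟩

/-- Over a point `y` whose local ring is a valuation ring, a proper birational morphism has a point
with the same local ring: the valuative criterion extends the inverse of the morphism from the
generic point to the spectrum of the local ring at `y`, and the local ring of the image of the
closed point lies in the local ring at `y`. -/
theorem IsBirationalMorphism.exists_stalkMap_surjective [IsProper f] (hf : IsBirationalMorphism f)
    (y : Y) [ValuationRing (Y.presheaf.stalk y)] :
    ∃ x : X, f x = y ∧ Function.Surjective (f.stalkMap x) := by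
  have h0 := hf.map_genericPoint
  have hbij := hf.bijective_functionFieldMap
  have hy : genericPoint Y ⤳ y := (genericPoint_spec Y).specializes trivial
  let φ : Y.presheaf.stalk y ⟶ X.functionField :=
    Y.presheaf.stalkSpecializes hy ≫ functionFieldMap f h0
  have hfrac : letI := φ.hom.toAlgebra; IsFractionRing (Y.presheaf.stalk y) X.functionField :=
    (IsLocalization.isLocalization_iff_of_ringEquiv (nonZeroDivisors (Y.presheaf.stalk y))
      (RingEquiv.ofBijective (functionFieldMap f h0).hom hbij)).mp
        (inferInstanceAs (IsFractionRing (Y.presheaf.stalk y) Y.functionField))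
  obtain ⟨l, hl₁, hl₂⟩ := exists_lift_of_isProper f _ _ (Field.toIsField X.functionField) φ hfrac
    (X.fromSpecStalk (genericPoint X)) (Y.fromSpecStalk y) (specMap_functionFieldMap h0 hy)
  let c : ↥(Spec (Y.presheaf.stalk y)) := IsLocalRing.closedPoint (Y.presheaf.stalk y)
  have hx : f (l c) = y :=
    congr($hl₂ c).trans Scheme.fromSpecStalk_closedPoint
  have hxgen : genericPoint X ⤳ l c := (genericPoint_spec X).specializes trivial
  let ψ : X.presheaf.stalk (l c) ⟶ Y.presheaf.stalk y := Scheme.stalkClosedPointTo l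
  have hψ : ψ ≫ φ = X.presheaf.stalkSpecializes hxgen := by
    apply Spec.map_injective
    rw [← cancel_mono (X.fromSpecStalk (l c)), Scheme.SpecMap_stalkSpecializes_fromSpecStalk, ← hl₁,
      Spec.map_comp, Category.assoc]
    congr 1
    exact Scheme.Spec_stalkClosedPointTo_fromSpecStalk l
  refine ⟨l c, hx, fun a => ?_⟩
  have hrange : ∀ z, z = y → ∀ b : Y.presheaf.stalk y,
      ∃ b' : Y.presheaf.stalk z, algebraMap _ Y.functionField b' = algebraMap _ _ b := by
    rintro _ rfl b
    exact ⟨b, rfl⟩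
  obtain ⟨b, hb⟩ := hrange _ hx (ψ a)
  refine ⟨b, IsFractionRing.injective (X.presheaf.stalk (l c)) X.functionField ?_⟩
  rw [← functionFieldMap_algebraMap f h0, hb]
  exact congr($hψ a)

variable [IsLocallyNoetherian X] [IsLocallyNoetherian Y]

/-- A rational function on `Y` whose divisor on `X` is supported on the exceptional divisors is
regular on `Y`: a point of codimension one of `Y` lies under a point of `X` with the same local
ring, where the order vanishes by assumption. -/
theorem IsBirationalMorphism.mem_range_stalk_of_ord_eq_zero [IsProper f]
    (hf : IsBirationalMorphism f) (hY : IsNormalScheme Y) {g : Y.functionField} (hg : g ≠ 0)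
    (h : ∀ x : X, coheight x = 1 → coheight (f x) = 1 →
      Scheme.ord (functionFieldMap f hf.map_genericPoint g) x = 0) (y : Y) :
    g ∈ (algebraMap (Y.presheaf.stalk y) Y.functionField).range := by
  have hbij := hf.bijective_functionFieldMap
  refine mem_range_stalk_of_forall_coheight_eq_one hY g (fun y hy => ?_) y
  have hdvr := isDiscreteValuationRing_stalk hY hy
  obtain ⟨x, rfl, hsurj⟩ := hf.exists_stalkMap_surjective y
  have hinj : Function.Injective (f.stalkMap x) := fun a b hab => by
    refine IsFractionRing.injective (Y.presheaf.stalk (f x)) Y.functionField (hbij.1 ?_)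
    rw [functionFieldMap_algebraMap, functionFieldMap_algebraMap, hab]
  let e : Y.presheaf.stalk (f x) ≃+* X.presheaf.stalk x :=
    RingEquiv.ofBijective (f.stalkMap x).hom ⟨hinj, hsurj⟩
  have hdvr' : IsDiscreteValuationRing (X.presheaf.stalk x) :=
    IsDiscreteValuationRing.RingEquivClass.isDiscreteValuationRing e
  have hx : coheight x = 1 := by
    have h1 := ringKrullDim_stalk_eq_coheight x
    rw [← ringKrullDim_eq_of_ringEquiv e, ringKrullDim_stalk_eq_coheight, hy] at h1
    exact_mod_cast h1.symm
  obtain ⟨a, ha⟩ := ExcDiv.mem_range_stalk_of_ord_eq_zero hx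
    (map_ne_zero_iff (functionFieldMap f hf.map_genericPoint).hom hbij.1 |>.mpr hg) (h x hx hy)
  obtain ⟨c, rfl⟩ := hsurj a
  refine ⟨c, hbij.1 ?_⟩
  rw [functionFieldMap_algebraMap]
  exact ha

/-- A rational function whose divisor is supported on the exceptional divisors of a proper
birational morphism to a normal scheme has trivial divisor. -/
theorem IsBirationalMorphism.ord_eq_zero [IsProper f] (hf : IsBirationalMorphism f)
    (hY : IsNormalScheme Y) {g : X.functionField} (hg : g ≠ 0)
    (h : ∀ x : X, coheight x = 1 → coheight (f x) = 1 → Scheme.ord g x = 0) (x : X) :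
    Scheme.ord g x = 0 := by
  -- both `g` and its inverse, as functions on `Y`, are regular at `f x`
  obtain ⟨g, rfl⟩ := hf.bijective_functionFieldMap.2 g
  have hg0 : g ≠ 0 := by
    rintro rfl
    exact hg (map_zero (functionFieldMap f hf.map_genericPoint).hom)
  obtain ⟨a, ha⟩ := hf.mem_range_stalk_of_ord_eq_zero hY hg0 h (f x)
  have hinv : functionFieldMap f hf.map_genericPoint g⁻¹ =
      (functionFieldMap f hf.map_genericPoint g)⁻¹ :=
    map_inv₀ (functionFieldMap f hf.map_genericPoint).hom g
  obtain ⟨b, hb⟩ := hf.mem_range_stalk_of_ord_eq_zero hY (inv_ne_zero hg0) (fun z hz hz' => by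
    rw [hinv, ord_inv hg, h z hz hz', neg_zero]) (f x)
  have hab : a * b = 1 := by
    refine IsFractionRing.injective (Y.presheaf.stalk (f x)) Y.functionField ?_
    rw [map_mul, ha, hb, map_one, mul_inv_cancel₀ hg0]
  have hu : IsUnit (f.stalkMap x a) := (IsUnit.of_mul_eq_one _ hab).map (f.stalkMap x).hom
  rw [← ha, functionFieldMap_algebraMap]
  exact ord_algebraMap_of_isUnit hu

/-- The exceptional divisors have linearly independent classes `v E` in any group `M` in which a
relation between divisor classes comes from a principal divisor. Here `H` relates classes in `M` to
the divisors which they are the classes of. -/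
theorem IsBirationalMorphism.linearIndependent [IsProper f] (hf : IsBirationalMorphism f)
    (hY : IsNormalScheme Y) {M : Type*} [AddCommGroup M] (H : AddSubgroup (M × WeilDivisor X))
    (h0 : ∀ D : WeilDivisor X, (0, D) ∈ H → D ∈ principalDivisors X)
    (v : ExceptionalDivisor f → M) (hv : ∀ E, (v E, Finsupp.single E.1 1) ∈ H) :
    LinearIndependent ℤ v := by
  refine linearIndependent_iff.mpr fun l hl => ?_
  let ι : ExceptionalDivisor f → PrimeDivisor X := fun E => E.1
  have hι : Function.Injective ι := Subtype.val_injective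
  have hH : (Finsupp.linearCombination ℤ v l, Finsupp.mapDomain ι l) ∈ H := by
    clear hl
    induction l using Finsupp.induction_linear with
    | zero =>
      rw [map_zero, Finsupp.mapDomain_zero]
      exact H.zero_mem
    | add l l' h h' =>
      rw [map_add, Finsupp.mapDomain_add]
      exact H.add_mem h h'
    | single E n =>
      rw [Finsupp.linearCombination_single, Finsupp.mapDomain_single]
      have := H.zsmul_mem (hv E) n
      rwa [Prod.smul_mk, Finsupp.smul_single, smul_eq_mul, mul_one] at this
  rw [hl] at hH
  obtain ⟨g, hg, hD⟩ := h0 _ hH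
  refine Finsupp.mapDomain_injective hι (Finsupp.ext fun E => ?_)
  rw [hD E, Finsupp.mapDomain_zero, Finsupp.zero_apply]
  refine hf.ord_eq_zero hY hg (fun x hx hx' => ?_) E.1
  rw [← hD ⟨x, hx⟩]
  refine Finsupp.mapDomain_of_notMem_range _ _ ?_
  rintro ⟨E', h⟩
  have h2 := E'.2
  rw [show E'.1 = _ from h, hx'] at h2
  exact absurd h2 (by norm_num)

theorem IsBirationalMorphism.linearIndependent_cl [IsProper f] (hf : IsBirationalMorphism f)
    (hY : IsNormalScheme Y) :
    LinearIndependent ℤ (fun E : ExceptionalDivisor f => PrimeDivisor.cl E.1) := by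
  let q := QuotientAddGroup.mk' (principalDivisors X)
  refine hf.linearIndependent hY
    ((AddMonoidHom.fst _ _ - q.comp (AddMonoidHom.snd (Cl X) (WeilDivisor X))).ker)
    (fun D hD => ?_) _ (fun E => ?_)
  · rw [AddMonoidHom.mem_ker] at hD
    have hD : 0 - q D = 0 := hD
    rw [zero_sub, neg_eq_zero] at hD
    exact (QuotientAddGroup.eq_zero_iff D).mp hD
  · exact sub_self (PrimeDivisor.cl E.1)

end Birational

/-! ### Line bundles of divisors -/

section Pic

variable {X : Scheme.{u}} [IsIntegral X] [IsLocallyNoetherian X]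

namespace Pic

open LineBundleCocycle

theorem IsClassOf.one : IsClassOf (1 : Pic X) 0 :=
  ⟨LineBundleCocycle.one, rfl, fun _ => 1, fun x E _ => by
    rw [Units.val_one, ord_one, Finsupp.zero_apply], fun x y w hx hy => by
    rw [germ_one]
    simp⟩

theorem IsClassOf.mul {L L' : Pic X} {D D' : WeilDivisor X} (h : L.IsClassOf D)
    (h' : L'.IsClassOf D') : (L * L').IsClassOf (D + D') := by
  obtain ⟨c, rfl, f, hf, hc⟩ := h
  obtain ⟨c', rfl, f', hf', hc'⟩ := h'
  refine ⟨c.mul c', rfl, fun x => f x * f' x, fun x E hE => ?_, fun x y w hx hy => ?_⟩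
  · rw [Units.val_mul, Scheme.ord_mul (f x).ne_zero (f' x).ne_zero, hf x E hE.1, hf' x E hE.2,
      Finsupp.add_apply]
  · rw [germ_mul, Units.val_mul, map_mul, hc, hc', Units.val_mul, Units.val_mul, div_mul_div_comm]

theorem IsClassOf.inv {L : Pic X} {D : WeilDivisor X} (h : L.IsClassOf D) :
    L⁻¹.IsClassOf (-D) := by
  obtain ⟨c, rfl, f, hf, hc⟩ := h
  refine ⟨c.inv, rfl, fun x => (f x)⁻¹, fun x E hE => ?_, fun x y w hx hy => ?_⟩
  · rw [Units.val_inv_eq_inv_val, ord_inv (f x).ne_zero, hf x E hE, Finsupp.neg_apply]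
  · refine (congrArg (fun z : (X.presheaf.stalk w)ˣ => algebraMap _ X.functionField z.1)
      (germ_inv c hx hy)).trans ((map_units_inv _ _).trans ?_)
    refine (congrArg Inv.inv (hc x y w hx hy)).trans ?_
    rw [Units.val_inv_eq_inv_val, Units.val_inv_eq_inv_val, inv_div, inv_div_inv]

/-- A divisor whose line bundle is trivial is principal. -/
theorem IsClassOf.mem_principalDivisors {D : WeilDivisor X} (h : (1 : Pic X).IsClassOf D) :
    D ∈ principalDivisors X := by
  obtain ⟨c, hc, f, hf, hg⟩ := h
  obtain ⟨V, mem, hV, hV', h, H⟩ : Equivalent c LineBundleCocycle.one := Quotient.exact hc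
  -- `u x` is the trivialization near `x`, as a rational function
  let u : ∀ x, X.functionField := fun x =>
    algebraMap (X.presheaf.stalk x) X.functionField (germU (mem x) (h x)).1
  have hη : ∀ x, genericPoint X ∈ V x := fun x =>
    ((genericPoint_spec X).mem_open_set_iff (V x).isOpen).mpr ⟨x, trivial, mem x⟩
  have hu : ∀ (x w : X) (hw : w ∈ V x),
      u x = algebraMap (X.presheaf.stalk w) X.functionField (germU hw (h x)).1 := fun x w hw => by
    have : Nonempty (V x) := ⟨⟨x, mem x⟩⟩
    exact (Scheme.algebraMap_germ_eq_germToFunctionField X (mem x) _).trans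
      (Scheme.algebraMap_germ_eq_germToFunctionField X hw _).symm
  have hu0 : ∀ x, u x ≠ 0 := fun x => ((germU (mem x) (h x)).isUnit.map _).ne_zero
  have hfu : ∀ (x y w : X), w ∈ V x → w ∈ V y →
      (f x : X.functionField) * u x = (f y : X.functionField) * u y := fun x y w hx hy => by
    have e := congr(algebraMap (X.presheaf.stalk w) X.functionField (Units.val $(H x y w hx hy)))
    rw [germ_one, one_mul, Units.val_mul, map_mul, hg, ← hu, ← hu] at e
    rw [e]
    field_simp
  -- the trivialization turns the local equations into one rational function, since the members of
  -- the cover all contain the generic point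
  have key : ∀ x y, (f x : X.functionField) * u x = (f y : X.functionField) * u y := fun x y =>
    hfu x y _ (hη x) (hη y)
  refine ⟨f (genericPoint X) * u (genericPoint X), mul_ne_zero (Units.ne_zero _) (hu0 _),
    fun E => ?_⟩
  rw [key _ E.1, Scheme.ord_mul (Units.ne_zero _) (hu0 _), hf E.1 E (hV _ (mem _)),
    ord_algebraMap_of_isUnit (Units.isUnit _), add_zero]

/-- The subgroup of the pairs of a line bundle `L` and a divisor `D` with `L = 𝒪(D)`. -/
def classOfSubgroup : AddSubgroup (Additive (Pic X) × WeilDivisor X) where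
  carrier := {p | p.1.toMul.IsClassOf p.2}
  zero_mem' := IsClassOf.one
  add_mem' := IsClassOf.mul
  neg_mem' := IsClassOf.inv

end Pic

end Pic

/-- The line bundles of the exceptional divisors of a proper birational morphism to a normal scheme
are linearly independent. -/
theorem IsBirationalMorphism.linearIndependent_pic {X Y : Scheme.{u}} [IsIntegral X] [IsIntegral Y]
    [IsLocallyNoetherian X] [IsLocallyNoetherian Y] {f : X ⟶ Y} [IsProper f]
    (hf : IsBirationalMorphism f) (hY : IsNormalScheme Y) (L : ExceptionalDivisor f → Pic X)
    (hL : ∀ E, (L E).IsClassOf (Finsupp.single E.1 1)) :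
    LinearIndependent ℤ (fun E : ExceptionalDivisor f => Additive.ofMul (L E)) :=
  hf.linearIndependent hY Pic.classOfSubgroup
    (fun _ h => Pic.IsClassOf.mem_principalDivisors h) _ hL

/-! ### Rings of invariants -/

section Invariants

variable {R A B : Type*} [CommRing R] [CommRing A] [CommRing B] [Algebra R A] [Algebra R B]
  [Algebra A B] [IsScalarTower R A B]

/-- The ring `A` of invariants of an automorphism of finite order of an algebra `B` of finite type
over a Noetherian ring is Noetherian, by the Artin–Tate lemma, because `B` is integral over `A`. -/
theorem isNoetherianRing_of_invariants [IsNoetherianRing R] [Algebra.FiniteType R B]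
    (hinj : Function.Injective (algebraMap A B)) (σ : B →ₐ[A] B) {n : ℕ} (hn : n ≠ 0)
    (hσ : σ ^ n = 1) (h : ∀ b, σ b = b → b ∈ Set.range (algebraMap A B)) :
    IsNoetherianRing A := by
  let τ : B ≃ₐ[A] B := AlgEquiv.algHomUnitsEquiv A B (Units.ofPowEqOne σ n hσ hn)
  have hτn : τ ^ n = 1 := by
    rw [← map_pow, Units.pow_ofPowEqOne, map_one]
  have hfin : Finite (Subgroup.zpowers τ) :=
    (isOfFinOrder_iff_pow_eq_one.mpr ⟨n, Nat.pos_of_ne_zero hn, hτn⟩).finite_zpowers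
  have : Algebra.IsInvariant A B (Subgroup.zpowers τ) :=
    ⟨fun b hb => h b (hb ⟨τ, Subgroup.mem_zpowers τ⟩)⟩
  have : Algebra.IsIntegral A B := Algebra.IsInvariant.isIntegral A B (Subgroup.zpowers τ)
  have : Algebra.FiniteType A B := .of_restrictScalars_finiteType R A B
  have : Module.Finite A B := Algebra.IsIntegral.finite
  have : Algebra.FiniteType R A :=
    ⟨fg_of_fg_of_fg R A B Algebra.FiniteType.out Module.Finite.fg_top hinj⟩
  exact Algebra.FiniteType.isNoetherianRing R A

/-- The ring `A` of invariants of an endomorphism of a normal domain `B` is normal: an element of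
`Frac A` that is integral over `A` lies in `B`, and it is invariant. -/
theorem isIntegrallyClosed_of_invariants [IsDomain A] [IsDomain B] [IsIntegrallyClosed B]
    (hinj : Function.Injective (algebraMap A B)) (σ : B →ₐ[A] B)
    (h : ∀ b, σ b = b → b ∈ Set.range (algebraMap A B)) : IsIntegrallyClosed A := by
  rw [isIntegrallyClosed_iff (FractionRing A)]
  intro x hx
  obtain ⟨a, b, hb, rfl⟩ := IsFractionRing.div_surjective (A := A) x
  have hb0 : b ≠ 0 := nonZeroDivisors.ne_zero hb
  have hinj' : Function.Injective (algebraMap A (FractionRing B)) := by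
    rw [IsScalarTower.algebraMap_eq A B]
    exact (IsFractionRing.injective B (FractionRing B)).comp hinj
  let φ : FractionRing A →ₐ[A] FractionRing B :=
    IsFractionRing.liftAlgHom (g := Algebra.ofId A (FractionRing B)) hinj'
  have hφ : IsIntegral B (φ (algebraMap A _ a / algebraMap A _ b)) := (hx.map φ).tower_top
  obtain ⟨c, hc⟩ := IsIntegrallyClosed.isIntegral_iff.mp hφ
  have hbB : algebraMap A B b ≠ 0 := (map_ne_zero_iff _ hinj).mpr hb0
  have hcb : c * algebraMap A B b = algebraMap A B a := by
    apply IsFractionRing.injective B (FractionRing B)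
    rw [map_mul, hc, map_div₀, AlgHom.commutes, AlgHom.commutes,
      ← IsScalarTower.algebraMap_apply, ← IsScalarTower.algebraMap_apply]
    exact div_mul_cancel₀ _ ((map_ne_zero_iff _ hinj').mpr hb0)
  -- `c` is invariant because `a` and `b` are and `c b = a`
  obtain ⟨d, rfl⟩ := h c (mul_right_cancel₀ hbB (by
    rw [hcb, ← σ.commutes b, ← map_mul, hcb, σ.commutes]))
  refine ⟨d, ?_⟩
  rw [eq_div_iff ((map_ne_zero_iff _ (IsFractionRing.injective A _)).mpr hb0), ← map_mul]
  exact congrArg _ (hinj (by rw [map_mul, hcb]))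

end Invariants

/-! ### The quotient by an automorphism of finite order -/

namespace IsQuotientBy

variable {Y Q : Scheme.{u}} {ζ : Y ⟶ Y} {q : Y ⟶ Q}

theorem preimage_le (h : IsQuotientBy ζ q) (U : Q.Opens) : q ⁻¹ᵁ U ≤ ζ ⁻¹ᵁ (q ⁻¹ᵁ U) := by
  rw [← Scheme.Hom.comp_preimage, h.comm]

theorem app_comp_appLE (h : IsQuotientBy ζ q) (U : Q.Opens) :
    q.app U ≫ ζ.appLE (q ⁻¹ᵁ U) (q ⁻¹ᵁ U) (h.preimage_le U) = q.app U := by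
  rw [Scheme.Hom.app_eq_appLE, Scheme.Hom.appLE_comp_appLE]
  simp_rw [h.comm]

/-- The action of `ζ` on the functions on the preimage of an open subset `U` of the quotient, which
is linear over the functions on `U`. -/
def actionAlgHom (h : IsQuotientBy ζ q) (U : Q.Opens) :
    letI := (q.app U).hom.toAlgebra
    Γ(Y, q ⁻¹ᵁ U) →ₐ[Γ(Q, U)] Γ(Y, q ⁻¹ᵁ U) :=
  letI := (q.app U).hom.toAlgebra
  { (ζ.appLE (q ⁻¹ᵁ U) (q ⁻¹ᵁ U) (h.preimage_le U)).hom with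
    commutes' := fun a => congr($(h.app_comp_appLE U) a) }

theorem actionAlgHom_pow_eq_one {ζ : End Y} (h : IsQuotientBy ζ q) (U : Q.Opens) {n : ℕ}
    (hn : ζ ^ n = 1) :
    let := (q.app U).hom.toAlgebra
    h.actionAlgHom U ^ n = 1 := by
  intro
  have hid : ∀ (e : q ⁻¹ᵁ U ≤ (𝟙 Y : Y ⟶ Y) ⁻¹ᵁ (q ⁻¹ᵁ U)) (b : Γ(Y, q ⁻¹ᵁ U)),
      (𝟙 Y : Y ⟶ Y).appLE _ _ e b = b := fun e b => by
    have : (𝟙 Y : Y ⟶ Y).appLE _ _ e = 𝟙 _ := by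
      rw [Scheme.Hom.appLE, Scheme.Hom.id_app]
      exact (Category.id_comp _).trans (Y.presheaf.map_id _)
    rw [this]
    rfl
  -- `ξ` is the power `ζ ^ m`, taken in `End Y`, as a morphism of schemes
  have key : ∀ m : ℕ, ∃ (ξ : Y ⟶ Y) (_ : ζ ^ m = ξ) (e : q ⁻¹ᵁ U ≤ ξ ⁻¹ᵁ (q ⁻¹ᵁ U)),
      ∀ b, (h.actionAlgHom U ^ m) b = ξ.appLE _ _ e b := by
    intro m
    induction m with
    | zero =>
      refine ⟨𝟙 Y, rfl, le_rfl, fun b => ?_⟩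
      exact (hid le_rfl b).symm
    | succ m ih =>
      obtain ⟨ξ, hξ, e, he⟩ := ih
      refine ⟨ζ ≫ ξ, by rw [pow_succ, hξ]; rfl, (h.preimage_le U).trans fun x hx => e hx,
        fun b => ?_⟩
      rw [← Scheme.Hom.appLE_comp_appLE _ _ _ _ _ e (h.preimage_le U), pow_succ',
        AlgHom.mul_apply, he]
      rfl
  obtain ⟨ξ, hξ, e, he⟩ := key n
  obtain rfl : 𝟙 Y = ξ := hn.symm.trans hξ
  ext b
  exact (he b).trans (hid e b)

/-- The quotient map is dominant: if the preimage of `U` is empty, then there are no nonzero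
functions on `U`. -/
theorem nonempty_preimage (h : IsQuotientBy ζ q) (U : Q.Opens) [Nonempty U] :
    Nonempty (q ⁻¹ᵁ U) := by
  by_contra hV
  have hV' : q ⁻¹ᵁ U = ⊥ := by
    ext x
    exact ⟨fun hx => hV ⟨⟨x, hx⟩⟩, fun hx => hx.elim⟩
  have : Subsingleton Γ(Y, q ⁻¹ᵁ U) := by
    rw [hV']
    infer_instance
  have : Subsingleton Γ(Q, U) := (h.injective U).subsingleton
  have x : U := Classical.arbitrary U
  have := (Q.presheaf.germ U x.1 x.2).hom.domain_nontrivial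
  exact not_subsingleton Γ(Q, U) inferInstance

theorem isIntegral (h : IsQuotientBy ζ q) [IsIntegral Y] : IsIntegral Q where
  nonempty := ⟨q (genericPoint Y)⟩
  component_integral U hU := by
    have := h.nonempty_preimage U
    exact (h.injective U).isDomain (q.app U).hom

theorem isNormalScheme (h : IsQuotientBy ζ q) [IsIntegral Y] (hY : IsNormalScheme Y) :
    IsNormalScheme Q := by
  have := h.isIntegral
  refine isNormalScheme_of_forall_isIntegrallyClosed fun U hU _ => ?_
  have : IsAffineHom q := h.isAffineHom
  have hV : IsAffineOpen (q ⁻¹ᵁ U) := hU.preimage q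
  have := h.nonempty_preimage U
  have := isIntegrallyClosed_section hY hV
  algebraize [(q.app U).hom]
  exact isIntegrallyClosed_of_invariants (B := Γ(Y, q ⁻¹ᵁ U)) (h.injective U) (h.actionAlgHom U)
    fun b hb => (h.mem_range_iff U (h.preimage_le U) b).mpr hb

/-- The quotient of a scheme locally of finite type over a Noetherian affine base is locally
Noetherian. -/
theorem isLocallyNoetherian {ζ : End Y} (h : IsQuotientBy ζ q) {n : ℕ} (hn : n ≠ 0)
    (hζ : ζ ^ n = 1) {S : Scheme.{u}} [IsAffine S] [IsLocallyNoetherian S] (g : Q ⟶ S)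
    [LocallyOfFiniteType (q ≫ g)] : IsLocallyNoetherian Q where
  component_noetherian U := by
    have : IsAffineHom q := h.isAffineHom
    have hV : IsAffineOpen (q ⁻¹ᵁ U.1) := U.2.preimage q
    have : IsNoetherianRing Γ(S, ⊤) :=
      IsLocallyNoetherian.component_noetherian ⟨⊤, isAffineOpen_top S⟩
    have hft : (g.appLE ⊤ U.1 le_top ≫ q.app U.1).hom.FiniteType := by
      have := (q ≫ g).finiteType_appLE (isAffineOpen_top S) hV le_top
      rw [← Scheme.Hom.appLE_comp_appLE q g ⊤ U.1 (q ⁻¹ᵁ U.1) le_top le_rfl] at this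
      rwa [Scheme.Hom.app_eq_appLE]
    algebraize [(q.app U.1).hom, (g.appLE ⊤ U.1 le_top).hom,
      (q.app U.1).hom.comp (g.appLE ⊤ U.1 le_top).hom]
    have : Algebra.FiniteType Γ(S, ⊤) Γ(Y, q ⁻¹ᵁ U.1) := hft
    exact isNoetherianRing_of_invariants (R := Γ(S, ⊤)) (B := Γ(Y, q ⁻¹ᵁ U.1)) (h.injective U.1)
      (h.actionAlgHom U.1) hn (h.actionAlgHom_pow_eq_one U.1 hζ)
      fun b hb => (h.mem_range_iff U.1 (h.preimage_le U.1) b).mpr hb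

end IsQuotientBy

/-! ### The automorphism of a torsor -/

section Twist

open MonoidalCategory CartesianMonoidalCategory MonObj

variable {k : Type u} [Field k] {A Y : Over (Spec (.of k))} [MonObj A] [ModObj A Y]

/-- The order of the automorphism of the torsor divides the order of `ζ`. The orbit map
`a ↦ a • y` of the fixed geometric point `y` is equivariant, and every point of `Y` is of the form
`a • y` over the algebraic closure of `k`. -/
theorem IsTwistByFixedPoints.pow_eq_one {ζ : End A} {ζY : End Y} (hY : IsTorsor A Y)
    (h : IsTwistByFixedPoints (Y := Y) ζ ζY) {n : ℕ} (hn : ζ ^ n = 1) : ζY ^ n = 1 := by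
  obtain ⟨y, hy, -⟩ := h.exists_point
  have := hY.isIso_shear
  -- `o` is the orbit map `a ↦ a • y`
  let o : A ⊗ geomPt k ⟶ Y := (A ◁ y) ≫ act A Y
  have ho : o ≫ ζY = (ζ ▷ geomPt k) ≫ o := by
    simp only [o, Category.assoc, ← h.compatible]
    rw [← MonoidalCategory.tensorHom_def_assoc, ← id_tensorHom, tensorHom_comp_tensorHom_assoc,
      Category.id_comp, hy]
  have hon : ∀ m : ℕ, o ≫ (ζY ^ m : End Y) = ((ζ ^ m : End A) ▷ geomPt k) ≫ o := by
    intro m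
    induction m with
    | zero =>
      simp only [pow_zero, End.one_def, Category.comp_id, id_whiskerRight, Category.id_comp]
    | succ m ih =>
      rw [pow_succ', pow_succ', End.mul_def, End.mul_def, ← Category.assoc, ih, Category.assoc, ho,
        comp_whiskerRight, Category.assoc]
  -- `s` maps a point `x` to the element `a` of `A` with `x = a • y`
  let s : Y ⊗ geomPt k ⟶ A ⊗ geomPt k :=
    lift ((Y ◁ y) ≫ inv (lift (act A Y) (snd A Y)) ≫ fst A Y) (snd _ _)
  have hs : s ≫ o = fst Y (geomPt k) := by
    have e1 : s ≫ (A ◁ y) = (Y ◁ y) ≫ inv (lift (act A Y) (snd A Y)) := by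
      ext
      · simp [s]
      · have e3 : inv (lift (act A Y) (snd A Y)) ≫ snd A Y = snd Y Y := by
          rw [IsIso.inv_comp_eq, lift_snd]
        simp [s, e3]
    rw [← Category.assoc, e1, Category.assoc]
    have e2 : inv (lift (act A Y) (snd A Y)) ≫ act A Y = fst Y Y := by
      rw [IsIso.inv_comp_eq, lift_fst]
    rw [e2, whiskerLeft_fst]
  -- the projection of the base change of `Y` to the algebraic closure is flat and surjective
  have : Epi (fst Y (geomPt k)) := by
    have : Epi (fst Y (geomPt k)).left := by
      rw [Over.fst_left]
      have : Surjective (geomPt k).hom := by dsimp [geomPt]; infer_instance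
      have : Flat (geomPt k).hom := by dsimp [geomPt]; infer_instance
      exact Flat.epi_of_flat_of_surjective _
    exact (Over.forget _).epi_of_epi_map this
  rw [← cancel_epi (fst Y (geomPt k)), ← hs, Category.assoc, hon, hn]
  simp [End.one_def]

end Twist

end ExcDiv

theorem mainTheorem8 :
    (∀ (S' S : Scheme.{u}) [IsIntegral S'] [IsNoetherian S'] [IsIntegral S] [IsNoetherian S]
      (f : S' ⟶ S) [IsProper f],
      ExcDiv.IsNormalScheme S' → ExcDiv.IsNormalScheme S → ExcDiv.IsBirationalMorphism f →
      LinearIndependent ℤ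
        (fun E : ExcDiv.ExceptionalDivisor f => ExcDiv.PrimeDivisor.cl E.1)) ∧
    (∀ (k : Type u) [Field k] [NumberField k] (d p : ℕ) (_ : 2 ≤ d) (_ : p.Prime) (_ : 2 < p)
      (A : Over (Spec (.of k))) [GrpObj A] (_ : ExcDiv.IsAbelianVariety A d)
      (ζ : Aut A) [IsMonHom ζ.hom] (_ : orderOf ζ = p)
      (_ : {x : ExcDiv.geomPt k ⟶ A | x ≫ ζ.hom = x}.Finite)
      (Y : Over (Spec (.of k))) [ModObj A Y] (_ : ExcDiv.IsTorsor A Y)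
      (ζY : Aut Y) (_ : ExcDiv.IsTwistByFixedPoints ζ.hom ζY.hom)
      (Q : Over (Spec (.of k))) (q : Y ⟶ Q) (_ : ExcDiv.IsQuotientBy ζY.hom.left q.left)
      (X : Over (Spec (.of k))) [IsIntegral X.left] [Smooth X.hom]
      (r : X ⟶ Q) [IsProper r.left] (_ : ExcDiv.IsBirationalMorphism r.left),
      LinearIndependent ℤ
        (fun E : ExcDiv.ExceptionalDivisor r.left => ExcDiv.PrimeDivisor.cl E.1) ∧
      ∀ L : ExcDiv.ExceptionalDivisor r.left → ExcDiv.Pic X.left,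
        (∀ E, (L E).IsClassOf (Finsupp.single E.1 1)) →
        LinearIndependent ℤ
          (fun E : ExcDiv.ExceptionalDivisor r.left => Additive.ofMul (L E))) := by
  refine ⟨fun S' S _ _ _ _ f _ _ hS hf => hf.linearIndependent_cl hS, ?_⟩
  intro k _ _ d p _ hp _ A _ _ ζ _ hζ _ Y _ hY ζY htw Q q hq X _ _ r _ hr
  let z : End Y := ζY.hom
  let z' : End Y.left := ζY.hom.left
  have hz : z ^ p = 1 := by
    refine ExcDiv.IsTwistByFixedPoints.pow_eq_one (ζ := (ζ.hom : End A)) hY htw ?_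
    have e : ζ ^ p = 1 := hζ ▸ pow_orderOf_eq_one ζ
    have e' := congr(Units.val (Aut.unitsEndEquivAut A |>.symm $e))
    rwa [map_pow, map_one] at e'
  have hz' : z' ^ p = 1 := by
    have e := congr((Over.forget (Spec (.of k))).mapEnd Y $hz)
    rwa [map_pow, map_one] at e
  have := hY.smooth
  have := hY.geometricallyIntegral
  have : IsIntegral Y.left := GeometricallyIntegral.isIntegral_of_subsingleton Y.hom
  have hQi : IsIntegral Q.left := hq.isIntegral
  have hQn : ExcDiv.IsNormalScheme Q.left :=
    hq.isNormalScheme (ExcDiv.isNormalScheme_of_smooth_field Y.hom)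
  have : LocallyOfFiniteType (q.left ≫ Q.hom) := by
    rw [Over.w q]
    infer_instance
  have : IsNoetherianRing (CommRingCat.of k) := inferInstanceAs (IsNoetherianRing k)
  have hQN : IsLocallyNoetherian Q.left :=
    ExcDiv.IsQuotientBy.isLocallyNoetherian (ζ := z') hq hp.ne_zero hz' Q.hom
  exact ⟨hr.linearIndependent_cl hQn, fun L hL => hr.linearIndependent_pic hQn L hL⟩

end
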